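/- Let $k$ be an infinite field with $\mathrm{char}(k)\neq 2$ and $\mathrm{char}(k)\neq 3$. For a $k$-vector space $V$ and $n\ge 0$ let $\mathcal{T}^{S^3}_V[n]=V^{\otimes \binom{n}{3}}$ (tensor product over $k$), with the tensor factors indexed by the triples $1\le i<j<l\le n$, and write its simple tensors as $\otimes_{1\le i<j<l\le n}(v_{i,j,l})$ with $v_{i,j,l}\in V$. Let $\mathcal{E}^{S^3}_V[n]$ be the subspace of $\mathcal{T}^{S^3}_V[n]$ spanned by the simple tensors $\otimes_{1\le i<j<l\le n}(v_{i,j,l})$ for which there exist $1\le x<y<z<t\le n$ with $v_{x,y,z}=v_{x,y,t}=v_{x,z,t}=v_{y,z,t}$, and put $$\Lambda^{S^3}_V[n]=\mathcal{T}^{S^3}_V[n]/\mathcal{E}^{S^3}_V[n].$$ **Corollary 4.10.** If $\dim_k V_2=2$, then $\dim_k \Lambda^{S^3}_{V_2}[6]=1$. Equivalently, there exists a nonzero linear map $det^{S^3}:V_2^{\otimes 20}\to k$, unique up to multiplication by a constant of $k$, such that $det^{S^3}(\otimes_{1\le i<j<l\le 6}(v_{i,j,l}))=0$ whenever there exist $1\le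 x<y<z<t\le 6$ with $v_{x,y,z}=v_{x,y,t}=v_{x,z,t}=v_{y,z,t}$. -/

import Mathlib

open scoped TensorProduct

/-- The increasing triples `i < j < k` of elements of an `n`-element ordered set: the hyperedges of
the complete 3-uniform hypergraph `K_n^3`. There are `n(n-1)(n-2)/6` of them. -/
structure Triple (n : ℕ) where
  i : Fin n
  j : Fin n
  k : Fin n
  hij : i < j
  hjk : j < k

/-- The family `(v_{i,j,k})` has four equal entries on the faces of some tetrahedron: there are
`x < y < z < t` with `v_{x,y,z} = v_{x,y,t} = v_{x,z,t} = v_{y,z,t}`. -/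
def HasEqualFaces {V : Type*} {n : ℕ} (v : Triple n → V) : Prop :=
  ∃ (x y z t : Fin n) (hxy : x < y) (hyz : y < z) (hzt : z < t),
    v ⟨x, y, z, hxy, hyz⟩ = v ⟨x, y, t, hxy, hyz.trans hzt⟩ ∧
    v ⟨x, y, t, hxy, hyz.trans hzt⟩ = v ⟨x, z, t, hxy.trans hyz, hzt⟩ ∧
    v ⟨x, z, t, hxy.trans hyz, hzt⟩ = v ⟨y, z, t, hyz, hzt⟩

section

variable (k : Type*) [Field k] (V : Type*) [AddCommGroup V] [Module k V]

/-- `𝒯^{S³}_V[n]`: the tensor power of `V` over `k` with one factor for each triple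
`1 ≤ i < j < k ≤ n`, that is `V^{⊗ n(n-1)(n-2)/6}`. -/
abbrev TS3 (n : ℕ) : Type _ := ⨂[k] _ : Triple n, V

/-- `ℰ^{S³}_V[n]`: the subspace spanned by the simple tensors `⊗ (v_{i,j,k})` with
`v_{x,y,z} = v_{x,y,t} = v_{x,z,t} = v_{y,z,t}` for some `x < y < z < t`. -/
def ES3 (n : ℕ) : Submodule k (TS3 k V n) :=
  Submodule.span k {ω | ∃ v : Triple n → V, HasEqualFaces v ∧ ω = PiTensorProduct.tprod k v}

/-- `Λ^{S³}_V[n] = 𝒯^{S³}_V[n] / ℰ^{S³}_V[n]`. -/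
abbrev LambdaS3 (n : ℕ) : Type _ := TS3 k V n ⧸ ES3 k V n

end

/-! For a basis `e` of `V`, the basis tensors are the `2 ^ 20` subsets (masks) of triples carrying
`e 1`. Over an infinite field, polarizing the vanishing condition of a form on one tetrahedron, with
the other entries fixed, says that for each `j` the values with `e 1` on exactly `j` of its faces
sum to zero.

Uniqueness: if all terms but one of such a relation vanish, so does the last. Starting from a single
well-chosen mask, this reaches every mask (`runSchedule_initialMask`), so a form vanishing there is
zero (`eq_zero_of_initialMask`).

Existence: place `v τ` on each triple and take simplicial boundaries. One-cycles on six vertices are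
determined on the ten edges avoiding vertex `0`, so with `dim V = 2` there are 20 boundary vectors
in a 20-dimensional space; take their determinant. Equal vectors on a tetrahedron make it vanish
because the boundary of a boundary is zero. At the chosen mask the matrix splits into two triangular
blocks with diagonal entries `±1`. -/

/-! ### Sets of bit masks stored as the binary digits of one number -/

/-- `f n`, evaluated only once `n` has been reduced to a numeral. -/
def strict (n : ℕ) (f : ℕ → ℕ) : ℕ := Nat.casesOn n (f 0) fun m => f m.succ

/-- `strict` only steers kernel evaluation: the case split forces a large argument to a literal
before `f` can duplicate it. -/
theorem strict_eq (n : ℕ) (f : ℕ → ℕ) : strict n f = f n := by cases n <;> rfl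

/-- The set of those `R < 2 ^ n` whose binary digits at the positions satisfying `p` all vanish. -/
def subcube (p : ℕ → Bool) : ℕ → ℕ
  | 0 => 1
  | n + 1 => strict (subcube p n) fun m => bif p n then m else Nat.lor m (Nat.shiftLeft m (2 ^ n))

/-- Adjoin to the set `Z` every `R + o` with `R ∈ M` and `o ∈ L` such that `R + o' ∈ Z` for all the
other members `o'` of `L`. -/
def propagate (M : ℕ) (L : List ℕ) (Z : ℕ) : ℕ :=
  L.foldl (fun A o => Nat.lor A (Nat.shiftLeft
    ((L.erase o).foldl (fun B o' => Nat.land B (Nat.shiftRight Z o')) M) o)) Z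

/-- One inclusion suffices: soundness needs only that every mask used avoids the given positions.
That enough masks occur is checked by the final computation. -/
theorem testBit_subcube {p : ℕ → Bool} {n R : ℕ} (h : (subcube p n).testBit R = true) :
    R < 2 ^ n ∧ ∀ i < n, p i = true → R.testBit i = false := by
  induction n generalizing R with
  | zero =>
    have : R = 0 := by simpa [subcube, Nat.testBit_one_eq_true_iff_self_eq_zero] using h
    simp [this]
  | succ n ih =>
    have hlow (h : (subcube p n).testBit R = true) :
        R < 2 ^ (n + 1) ∧ ∀ i < n + 1, p i = true → R.testBit i = false := by
      obtain ⟨h1, h2⟩ := ih h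
      refine ⟨h1.trans (Nat.pow_lt_pow_right one_lt_two n.lt_succ_self), fun i hi hpi => ?_⟩
      rcases Nat.lt_succ_iff_lt_or_eq.1 hi with hi | rfl
      · exact h2 i hi hpi
      · exact Nat.testBit_lt_two_pow h1
    rw [subcube, strict_eq] at h
    cases hp : p n with
    | true => exact hlow (by simpa [hp] using h)
    | false =>
      rw [hp, cond_false] at h
      change (subcube p n ||| subcube p n <<< 2 ^ n).testBit R = true at h
      rw [Nat.testBit_or, Bool.or_eq_true] at h
      rcases h with h | h
      · exact hlow h
      · rw [Nat.testBit_shiftLeft, Bool.and_eq_true, decide_eq_true_eq] at h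
        obtain ⟨r, rfl⟩ := Nat.exists_eq_add_of_le h.1
        rw [Nat.add_sub_cancel_left] at h
        obtain ⟨h1, h2⟩ := ih h.2
        refine ⟨by rw [pow_succ]; omega, fun i hi hpi => ?_⟩
        rcases Nat.lt_succ_iff_lt_or_eq.1 hi with hi | rfl
        · rw [Nat.testBit_two_pow_add_gt hi]
          exact h2 i hi hpi
        · simp [hp] at hpi

theorem testBit_foldl_lor (L : List ℕ) (g : ℕ → ℕ) (Z s : ℕ) :
    (L.foldl (fun A o => Nat.lor A (g o)) Z).testBit s = true ↔
      Z.testBit s = true ∨ ∃ o ∈ L, (g o).testBit s = true := by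
  induction L generalizing Z with
  | nil => simp
  | cons o L ih =>
    rw [List.foldl_cons, ih]
    change (Z ||| g o).testBit s = true ∨ _ ↔ _
    simp [or_assoc]

theorem testBit_foldl_land (L : List ℕ) (g : ℕ → ℕ) (Z s : ℕ) :
    (L.foldl (fun A o => Nat.land A (g o)) Z).testBit s = true ↔
      Z.testBit s = true ∧ ∀ o ∈ L, (g o).testBit s = true := by
  induction L generalizing Z with
  | nil => simp
  | cons o L ih =>
    rw [List.foldl_cons, ih]
    change (Z &&& g o).testBit s = true ∧ _ ↔ _
    simp [and_assoc]

/-- A newly adjoined `s` is `R + o` with every other term of the relation at `R` already known to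
vanish. All coefficients are one, so nothing has to be inverted. -/
theorem eq_zero_of_testBit_propagate {A : Type*} [AddCommGroup A] {f : ℕ → A} {M Z : ℕ}
    {L : List ℕ} (hL : ∀ R, M.testBit R = true → (L.map fun o => f (R + o)).sum = 0)
    (hZ : ∀ s, Z.testBit s = true → f s = 0) {s : ℕ}
    (hs : (propagate M L Z).testBit s = true) : f s = 0 := by
  rw [propagate, testBit_foldl_lor] at hs
  rcases hs with hs | ⟨o, ho, hs⟩
  · exact hZ s hs
  change (_ <<< o).testBit s = true at hs
  rw [Nat.testBit_shiftLeft, Bool.and_eq_true, decide_eq_true_eq, testBit_foldl_land] at hs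
  obtain ⟨hos, hM, hothers⟩ := hs
  have hsum := hL _ hM
  rw [((List.perm_cons_erase ho).map _).sum_eq, List.map_cons, List.sum_cons,
    Nat.sub_add_cancel hos] at hsum
  have hzero : (List.map (fun o' => f (s - o + o')) (L.erase o)).sum = 0 := by
    refine List.sum_eq_zero fun y hy => ?_
    obtain ⟨o', ho', rfl⟩ := List.mem_map.1 hy
    have := hothers o' ho'
    change ((Z >>> o').testBit _ = true) at this
    rw [Nat.testBit_shiftRight, add_comm] at this
    exact hZ _ this
  rwa [hzero, add_zero] at hsum

/-- There is no carry into an empty digit, so adjoining a triple to a mask is addition, and on sets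
of masks a shift. -/
theorem testBit_add_two_pow {R a : ℕ} (h : R.testBit a = false) (i : ℕ) :
    (R + 2 ^ a).testBit i = (decide (i = a) || R.testBit i) := by
  induction a generalizing R i with
  | zero =>
    have h0 : R % 2 = 0 := by simpa using h
    cases i with
    | zero => simp; omega
    | succ i =>
      rw [Nat.testBit_succ, Nat.testBit_succ, show (R + 2 ^ 0) / 2 = R / 2 by omega]
      simp
  | succ a ih =>
    rw [Nat.testBit_succ] at h
    cases i with
    | zero => simp [pow_succ]
    | succ i =>
      rw [Nat.testBit_succ, Nat.testBit_succ,
        show (R + 2 ^ (a + 1)) / 2 = R / 2 + 2 ^ a by rw [pow_succ]; omega, ih h]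
      simp

/-! ### Polarization -/

theorem eq_zero_of_forall_quartic_eq_zero {k : Type*} [Field k] [Infinite k] {c₀ c₁ c₂ c₃ c₄ : k}
    (h : ∀ t : k, c₀ + t * c₁ + t ^ 2 * c₂ + t ^ 3 * c₃ + t ^ 4 * c₄ = 0) :
    c₀ = 0 ∧ c₁ = 0 ∧ c₂ = 0 ∧ c₃ = 0 ∧ c₄ = 0 := by
  open Polynomial in
  have hP : (C c₀ + X * C c₁ + X ^ 2 * C c₂ + X ^ 3 * C c₃ + X ^ 4 * C c₄ : k[X]) = 0 :=
    Polynomial.funext fun t => by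
      simp only [Polynomial.eval_add, Polynomial.eval_mul, Polynomial.eval_pow, Polynomial.eval_C,
        Polynomial.eval_X, Polynomial.eval_zero]
      exact h t
  have hc (n : ℕ) := congrArg (fun P => Polynomial.coeff P n) hP
  refine ⟨?_, ?_, ?_, ?_, ?_⟩
  · simpa [Polynomial.coeff_X_pow, Polynomial.coeff_C, Polynomial.coeff_X] using hc 0
  · simpa [Polynomial.coeff_X_pow, Polynomial.coeff_C, Polynomial.coeff_X] using hc 1
  · simpa [Polynomial.coeff_X_pow, Polynomial.coeff_C, Polynomial.coeff_X] using hc 2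
  · simpa [Polynomial.coeff_X_pow, Polynomial.coeff_C, Polynomial.coeff_X] using hc 3
  · simpa [Polynomial.coeff_X_pow, Polynomial.coeff_C, Polynomial.coeff_X] using hc 4

section Polarization

variable {k : Type*} [Field k] {V : Type*} [AddCommGroup V] [Module k V] {ι : Type*}
  [DecidableEq ι]

/-- The value of `F` at the family `w` with its entries at `a`, `b`, `c`, `d` replaced. -/
def evalFour (F : MultilinearMap k (fun _ : ι => V) k) (a b c d : ι) (w : ι → V)
    (x₁ x₂ x₃ x₄ : V) : k :=
  F (Function.update (Function.update (Function.update (Function.update w a x₁) b x₂) c x₃) d x₄)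

/-- These are the coefficients of `t ^ 0, ..., t ^ 4` when `x + t • y` is put in all four slots. -/
theorem evalFour_relations [Infinite k] (F : MultilinearMap k (fun _ : ι => V) k) {a b c d : ι}
    (hab : a ≠ b) (hac : a ≠ c) (had : a ≠ d) (hbc : b ≠ c) (hbd : b ≠ d) (hcd : c ≠ d)
    (hF : ∀ v : ι → V, v a = v b → v b = v c → v c = v d → F v = 0) (w : ι → V) (x y : V) :
    let G := evalFour F a b c d w
    G x x x x = 0 ∧
    G y x x x + G x y x x + G x x y x + G x x x y = 0 ∧
    G y y x x + G y x y x + G y x x y + G x y y x + G x y x y + G x x y y = 0 ∧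
    G y y y x + G y y x y + G y x y y + G x y y y = 0 ∧
    G y y y y = 0 := by
  intro G
  -- Updates at distinct indices commute, so each slot can be made outermost, where linearity
  -- applies.
  have h₄ (x₁ x₂ x₃ u v : V) (t : k) : G x₁ x₂ x₃ (u + t • v) = G x₁ x₂ x₃ u + t * G x₁ x₂ x₃ v := by
    simp [G, evalFour]
  have h₃ (x₁ x₂ x₄ u v : V) (t : k) : G x₁ x₂ (u + t • v) x₄ = G x₁ x₂ u x₄ + t * G x₁ x₂ v x₄ := by
    simp [G, evalFour, Function.update_comm hcd]
  have h₂ (x₁ x₃ x₄ u v : V) (t : k) : G x₁ (u + t • v) x₃ x₄ = G x₁ u x₃ x₄ + t * G x₁ v x₃ x₄ := by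
    simp [G, evalFour, Function.update_comm hbc, Function.update_comm hbd]
  have h₁ (x₂ x₃ x₄ u v : V) (t : k) : G (u + t • v) x₂ x₃ x₄ = G u x₂ x₃ x₄ + t * G v x₂ x₃ x₄ := by
    simp [G, evalFour, Function.update_comm hab, Function.update_comm hac,
      Function.update_comm had]
  apply eq_zero_of_forall_quartic_eq_zero
  intro t
  have hG : G (x + t • y) (x + t • y) (x + t • y) (x + t • y) = 0 := by
    apply hF <;> simp [hab, hac, had, hbc, hbd, hcd]
  simp only [h₁, h₂, h₃, h₄] at hG
  linear_combination hG

end Polarization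

/-! ### Triples of vertices and their numbering -/

/-- Increasing triples as a subtype of the type of all triples. -/
def tripleEquiv (n : ℕ) :
    Triple n ≃ {p : Fin n × Fin n × Fin n // p.1 < p.2.1 ∧ p.2.1 < p.2.2} where
  toFun τ := ⟨(τ.i, τ.j, τ.k), τ.hij, τ.hjk⟩
  invFun p := ⟨p.1.1, p.1.2.1, p.1.2.2, p.2.1, p.2.2⟩
  left_inv _ := rfl
  right_inv _ := rfl

instance (n : ℕ) : DecidableEq (Triple n) := (tripleEquiv n).decidableEq

instance (n : ℕ) : Fintype (Triple n) := Fintype.ofEquiv _ (tripleEquiv n).symm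

/-- The position of the triple `i < j < k` in the colexicographic order. -/
def tripleCode (i j k : ℕ) : ℕ := i + j * (j - 1) / 2 + k * (k - 1) * (k - 2) / 6

def Triple.code {n : ℕ} (τ : Triple n) : ℕ := tripleCode τ.i τ.j τ.k

theorem Triple.code_injective : Function.Injective (Triple.code : Triple 6 → ℕ) := by
  have h : ∀ σ τ : Triple 6, σ.code = τ.code → σ = τ := by decide +kernel
  exact fun σ τ => h σ τ

theorem Triple.code_lt (τ : Triple 6) : τ.code < 20 := by
  revert τ
  decide +kernel

/-- The sums of `j` of the four numbers `a`, `b`, `c`, `d`. -/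
def layer (a b c d : ℕ) : ℕ → List ℕ
  | 0 => [0]
  | 1 => [a, b, c, d]
  | 2 => [a + b, a + c, a + d, b + c, b + d, c + d]
  | 3 => [a + b + c, a + b + d, a + c + d, b + c + d]
  | _ => [a + b + c + d]

/-- Propagation along the relations, with `j` second basis vectors on the faces, of the tetrahedron
`x < y < z < t`. -/
def tetrahedronStep (x y z t j Z : ℕ) : ℕ :=
  let a := tripleCode x y z
  let b := tripleCode x y t
  let c := tripleCode x z t
  let d := tripleCode y z t
  strict Z (propagate (subcube (fun n => n == a || n == b || n == c || n == d) 20)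
      (layer (2 ^ a) (2 ^ b) (2 ^ c) (2 ^ d) j))

/-- An order of the relations `(x, y, z, t, j)` in which propagation reaches every mask. -/
def schedule : List (ℕ × ℕ × ℕ × ℕ × ℕ) :=
  [(0, 1, 2, 3, 0), (0, 1, 2, 3, 4), (0, 1, 2, 4, 0), (0, 1, 2, 4, 4), (0, 1, 2, 5, 0),
   (0, 1, 2, 5, 4), (0, 1, 3, 4, 0), (0, 1, 3, 4, 4), (0, 1, 3, 5, 0), (0, 1, 3, 5, 4),
   (0, 1, 4, 5, 0), (0, 1, 4, 5, 4), (0, 2, 3, 4, 0), (0, 2, 3, 4, 4), (0, 2, 3, 5, 0),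
   (0, 2, 3, 5, 4), (0, 2, 4, 5, 0), (0, 2, 4, 5, 4), (0, 3, 4, 5, 0), (0, 3, 4, 5, 4),
   (1, 2, 3, 4, 0), (1, 2, 3, 4, 4), (1, 2, 3, 5, 0), (1, 2, 3, 5, 4), (1, 2, 4, 5, 0),
   (1, 2, 4, 5, 4), (1, 3, 4, 5, 0), (1, 3, 4, 5, 4), (2, 3, 4, 5, 0), (2, 3, 4, 5, 4),
   (0, 3, 4, 5, 1), (1, 2, 4, 5, 1), (0, 1, 4, 5, 3), (2, 3, 4, 5, 3), (1, 2, 3, 5, 1),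
   (0, 1, 3, 5, 3), (0, 1, 3, 5, 1), (0, 1, 2, 3, 3), (0, 1, 2, 4, 1), (1, 2, 3, 4, 3),
   (0, 2, 3, 4, 1), (0, 2, 4, 5, 3), (0, 1, 3, 4, 1), (0, 2, 3, 4, 3), (0, 1, 2, 3, 1),
   (2, 3, 4, 5, 1), (0, 1, 3, 4, 3), (0, 1, 2, 4, 3), (1, 2, 3, 5, 3), (0, 2, 4, 5, 1),
   (1, 2, 4, 5, 3), (1, 2, 3, 4, 1), (0, 2, 3, 5, 3), (0, 2, 3, 5, 1), (0, 3, 4, 5, 3),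
   (1, 3, 4, 5, 1), (0, 1, 2, 5, 1), (0, 1, 2, 4, 2), (0, 1, 4, 5, 3), (1, 2, 3, 4, 3),
   (0, 3, 4, 5, 2), (0, 2, 4, 5, 1), (0, 1, 3, 5, 3), (0, 2, 3, 4, 3), (2, 3, 4, 5, 1),
   (0, 1, 3, 5, 1), (0, 1, 2, 3, 1), (0, 1, 2, 5, 3), (0, 1, 3, 4, 3), (0, 1, 2, 5, 2),
   (0, 1, 4, 5, 1), (0, 1, 3, 4, 2), (1, 3, 4, 5, 3), (1, 3, 4, 5, 2), (0, 1, 3, 4, 1),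
   (0, 2, 4, 5, 3), (0, 1, 2, 3, 3), (2, 3, 4, 5, 3), (2, 3, 4, 5, 2), (0, 1, 2, 3, 2),
   (0, 1, 2, 3, 1), (0, 2, 4, 5, 2), (0, 1, 2, 4, 1), (0, 1, 3, 5, 1)]

def runSchedule (Z : ℕ) : ℕ :=
  schedule.foldl (fun Z s => tetrahedronStep s.1 s.2.1 s.2.2.1 s.2.2.2.1 s.2.2.2.2 Z) Z

theorem schedule_valid : ∀ s ∈ schedule, s.1 < s.2.1 ∧ s.2.1 < s.2.2.1 ∧ s.2.2.1 < s.2.2.2.1 ∧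
    s.2.2.2.1 < 6 := by
  decide +kernel

/-- A mask whose triples and whose other triples both form a collapsible complex. -/
def initialMask : ℕ := 337694

/-- The right side is the set of all masks below `2 ^ 20`. The first thirty steps (`j = 0` and `j =
4`) use one-term relations, seeding the masks constant on some tetrahedron; later steps feed on
these and on `initialMask`. -/
theorem runSchedule_initialMask : runSchedule (2 ^ initialMask) = 2 ^ 2 ^ 20 - 1 := by
  decide +kernel

/-- The family with entry `y` at the triples belonging to the mask `s` and `x` elsewhere. -/
def maskFamily {V : Type*} (x y : V) (s : ℕ) (τ : Triple 6) : V := if s.testBit τ.code then y else x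

theorem maskFamily_add_two_pow {V : Type*} (x y : V) {R : ℕ} {τ : Triple 6} (h : R.testBit τ.code = false) :
    maskFamily x y (R + 2 ^ τ.code) = Function.update (maskFamily x y R) τ y := by
  funext σ
  by_cases hσ : σ = τ
  · subst hσ
    simp [maskFamily, testBit_add_two_pow h]
  · have : σ.code ≠ τ.code := fun h => hσ (Triple.code_injective h)
    simp [maskFamily, testBit_add_two_pow h, hσ, this]

/-! ### Uniqueness: a form is determined by its value at one mask -/

section Uniqueness

variable {k : Type*} [Field k] {V : Type*} [AddCommGroup V] [Module k V]

theorem sum_layer_eq_zero [Infinite k] (F : MultilinearMap k (fun _ : Triple 6 => V) k)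
    {a b c d : Triple 6} (hab : a ≠ b) (hac : a ≠ c) (had : a ≠ d) (hbc : b ≠ c) (hbd : b ≠ d)
    (hcd : c ≠ d) (hF : ∀ v : Triple 6 → V, v a = v b → v b = v c → v c = v d → F v = 0) (x y : V)
    {R : ℕ} (ha : R.testBit a.code = false) (hb : R.testBit b.code = false)
    (hc : R.testBit c.code = false) (hd : R.testBit d.code = false) (j : ℕ) :
    ((layer (2 ^ a.code) (2 ^ b.code) (2 ^ c.code) (2 ^ d.code) j).map
      fun o => F (maskFamily x y (R + o))).sum = 0 := by
  have hne {σ τ : Triple 6} (h : σ ≠ τ) : σ.code ≠ τ.code := fun h' => h (Triple.code_injective h')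
  obtain ⟨h₀, h₁, h₂, h₃, h₄⟩ :=
    evalFour_relations F hab hac had hbc hbd hcd hF (maskFamily x y R) x y
  -- Each Boolean says whether `y` sits on the corresponding face; the digits of `R` there are
  -- empty, so the powers of two add without carry.
  have key (p q r s : Bool) : evalFour F a b c d (maskFamily x y R) (bif p then y else x)
      (bif q then y else x) (bif r then y else x) (bif s then y else x) =
      F (maskFamily x y (R + ((bif p then 2 ^ a.code else 0) + (bif q then 2 ^ b.code else 0) +
        (bif r then 2 ^ c.code else 0) + (bif s then 2 ^ d.code else 0)))) := by
    have upd {S : ℕ} {τ : Triple 6} (p : Bool) (h : S.testBit τ.code = false) :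
        Function.update (maskFamily x y S) τ (bif p then y else x) =
          maskFamily x y (S + bif p then 2 ^ τ.code else 0) := by
      cases p with
      | true => exact (maskFamily_add_two_pow x y h).symm
      | false => exact Function.update_eq_self_iff.2 (by simp [maskFamily, h])
    have bit {S : ℕ} {σ τ : Triple 6} (p : Bool) (hστ : σ ≠ τ) (h : S.testBit τ.code = false)
        (h' : S.testBit σ.code = false) :
        (S + bif p then 2 ^ σ.code else 0).testBit τ.code = false := by
      cases p with
      | true => simp [testBit_add_two_pow h', h, (hne hστ).symm]
      | false => simpa using h
    rw [evalFour, upd p ha, upd q (bit p hab hb ha),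
      upd r (bit q hbc (bit p hac hc ha) (bit p hab hb ha)),
      upd s (bit r hcd (bit q hbd (bit p had hd ha) (bit p hab hb ha))
        (bit q hbc (bit p hac hc ha) (bit p hab hb ha)))]
    simp only [add_assoc]
  match j with
  | 0 => simpa [layer] using (key false false false false).symm.trans h₀
  | 1 =>
    have e₁ := key true false false false
    have e₂ := key false true false false
    have e₃ := key false false true false
    have e₄ := key false false false true
    simp only [cond_true, cond_false, add_zero, zero_add] at e₁ e₂ e₃ e₄
    simp only [layer, List.map_cons, List.map_nil, List.sum_cons, List.sum_nil]
    linear_combination h₁ - e₁ - e₂ - e₃ - e₄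
  | 2 =>
    have e₁ := key true true false false
    have e₂ := key true false true false
    have e₃ := key true false false true
    have e₄ := key false true true false
    have e₅ := key false true false true
    have e₆ := key false false true true
    simp only [cond_true, cond_false, add_zero, zero_add] at e₁ e₂ e₃ e₄ e₅ e₆
    simp only [layer, List.map_cons, List.map_nil, List.sum_cons, List.sum_nil]
    linear_combination h₂ - e₁ - e₂ - e₃ - e₄ - e₅ - e₆
  | 3 =>
    have e₁ := key true true true false
    have e₂ := key true true false true
    have e₃ := key true false true true
    have e₄ := key false true true true
    simp only [cond_true, cond_false, add_zero, zero_add] at e₁ e₂ e₃ e₄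
    simp only [layer, List.map_cons, List.map_nil, List.sum_cons, List.sum_nil]
    linear_combination h₃ - e₁ - e₂ - e₃ - e₄
  | j + 4 => simpa [layer] using (key true true true true).symm.trans h₄

theorem eq_zero_of_testBit_tetrahedronStep [Infinite k]
    (F : MultilinearMap k (fun _ : Triple 6 => V) k) (hF : ∀ v, HasEqualFaces v → F v = 0)
    (e₀ e₁ : V) {x y z t : ℕ} (hxy : x < y) (hyz : y < z) (hzt : z < t) (ht : t < 6) (j : ℕ)
    {Z : ℕ} (hZ : ∀ s, Z.testBit s = true → F (maskFamily e₀ e₁ s) = 0) {s : ℕ}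
    (hs : (tetrahedronStep x y z t j Z).testBit s = true) : F (maskFamily e₀ e₁ s) = 0 := by
  have hz := hzt.trans ht
  have hy := hyz.trans hz
  have hx := hxy.trans hy
  let a : Triple 6 := ⟨⟨x, hx⟩, ⟨y, hy⟩, ⟨z, hz⟩, hxy, hyz⟩
  let b : Triple 6 := ⟨⟨x, hx⟩, ⟨y, hy⟩, ⟨t, ht⟩, hxy, hyz.trans hzt⟩
  let c : Triple 6 := ⟨⟨x, hx⟩, ⟨z, hz⟩, ⟨t, ht⟩, hxy.trans hyz, hzt⟩
  let d : Triple 6 := ⟨⟨y, hy⟩, ⟨z, hz⟩, ⟨t, ht⟩, hyz, hzt⟩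
  rw [tetrahedronStep, strict_eq] at hs
  refine eq_zero_of_testBit_propagate (fun R hR => ?_) hZ hs
  have hbit := (testBit_subcube hR).2
  refine sum_layer_eq_zero F (a := a) (b := b) (c := c) (d := d) ?_ ?_ ?_ ?_ ?_ ?_
    (fun v h₁ h₂ h₃ => hF v ⟨_, _, _, _, hxy, hyz, hzt, h₁, h₂, h₃⟩) e₀ e₁
    (hbit _ a.code_lt (by simp [a, Triple.code])) (hbit _ b.code_lt (by simp [b, Triple.code]))
    (hbit _ c.code_lt (by simp [c, Triple.code])) (hbit _ d.code_lt (by simp [d, Triple.code])) j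
  all_goals
    simp only [a, b, c, d, ne_eq, Triple.mk.injEq, Fin.mk.injEq]
    omega

theorem eq_zero_of_initialMask [Infinite k] (F : MultilinearMap k (fun _ : Triple 6 => V) k)
    (hF : ∀ v, HasEqualFaces v → F v = 0) (e : Module.Basis (Fin 2) k V)
    (h₀ : F (maskFamily (e 0) (e 1) initialMask) = 0) : F = 0 := by
  have hrun : ∀ l : List (ℕ × ℕ × ℕ × ℕ × ℕ), (∀ s ∈ l, s.1 < s.2.1 ∧ s.2.1 < s.2.2.1 ∧
      s.2.2.1 < s.2.2.2.1 ∧ s.2.2.2.1 < 6) → ∀ Z : ℕ,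
      (∀ s, Z.testBit s = true → F (maskFamily (e 0) (e 1) s) = 0) → ∀ s,
      (l.foldl (fun Z s => tetrahedronStep s.1 s.2.1 s.2.2.1 s.2.2.2.1 s.2.2.2.2 Z) Z).testBit s =
        true → F (maskFamily (e 0) (e 1) s) = 0 := by
    intro l
    induction l with
    | nil => exact fun _ _ hZ => hZ
    | cons q l ih =>
      intro hl Z hZ
      obtain ⟨h₁, h₂, h₃, h₄⟩ := hl q List.mem_cons_self
      exact ih (fun s hs => hl s (List.mem_cons_of_mem _ hs)) _ fun s hs =>
        eq_zero_of_testBit_tetrahedronStep F hF (e 0) (e 1) h₁ h₂ h₃ h₄ _ hZ hs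
  have hall (s : ℕ) (hs : s < 2 ^ 20) : F (maskFamily (e 0) (e 1) s) = 0 := by
    refine hrun schedule schedule_valid (2 ^ initialMask) (fun s hs => ?_) s ?_
    · rw [Nat.testBit_two_pow, decide_eq_true_eq] at hs
      rwa [← hs]
    · change (runSchedule (2 ^ initialMask)).testBit s = true
      rw [runSchedule_initialMask, Nat.testBit_two_pow_sub_one, decide_eq_true_eq]
      exact hs
  refine Module.Basis.ext_multilinear (fun _ => e) fun v => ?_
  have hcode : ∀ i : Fin 20, ∃ τ : Triple 6, τ.code = i := by decide +kernel
  choose g hg using hcode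
  -- Every basis family is a mask family: `g` inverts the numbering, and the mask collects the
  -- triples where the index is `1`.
  have hv : (fun τ => e (v τ)) =
      maskFamily (e 0) (e 1) (Nat.ofBits fun i : Fin 20 => decide (v (g i) = 1)) := by
    funext τ
    have hgτ : g ⟨τ.code, τ.code_lt⟩ = τ := Triple.code_injective (hg _)
    rw [maskFamily, Nat.testBit_ofBits_lt _ _ τ.code_lt, hgτ]
    generalize v τ = i
    fin_cases i <;> simp
  rw [hv, hall _ (Nat.ofBits_lt_two_pow _), zero_apply]

end Uniqueness

/-! ### The determinant -/

/-- The coefficient of the oriented edge `p → q` in the boundary of a triple. -/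
def Triple.boundaryCoeff {n : ℕ} (τ : Triple n) (p q : Fin n) : ℤ :=
  (if p = τ.i ∧ q = τ.j then 1 else 0) - (if p = τ.i ∧ q = τ.k then 1 else 0) +
    (if p = τ.j ∧ q = τ.k then 1 else 0)

/-- The edges of the complete graph on `Fin n` that avoid the vertex `0`; a one-dimensional cycle is
determined by its coefficients there. -/
abbrev ReducedEdge (n : ℕ) [NeZero n] : Type := {p : Fin n × Fin n // 0 < p.1 ∧ p.1 < p.2}

/-- The coincidence `10 * 2 = 20` makes the boundary matrix square. -/
theorem card_triple_six :
    Fintype.card (Σ _ : ReducedEdge 6, Fin 2) = Fintype.card (Triple 6) := by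
  decide +kernel

/-- For every triple a reduced edge in its boundary, and a rank: among the triples on the same side
of `initialMask`, all others having that edge in the boundary have smaller rank. -/
def collapse : List (Fin 6 × Fin 6 × ℕ) :=
  [(1, 2, 7), (1, 3, 6), (2, 3, 4), (1, 2, 0), (1, 4, 7), (2, 4, 8), (1, 4, 5), (3, 4, 3),
    (3, 4, 5), (2, 4, 3), (1, 5, 1), (2, 5, 9), (1, 5, 6), (3, 5, 8), (1, 3, 0), (2, 3, 1),
    (4, 5, 9), (4, 5, 4), (2, 5, 2), (3, 5, 2)]

def Triple.collapseEntry (τ : Triple 6) : Fin 6 × Fin 6 × ℕ := collapse.getD τ.code (0, 0, 0)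

theorem Triple.collapseEntry_spec (τ : Triple 6) :
    (0 < τ.collapseEntry.1 ∧ τ.collapseEntry.1 < τ.collapseEntry.2.1) ∧
    IsUnit (τ.boundaryCoeff τ.collapseEntry.1 τ.collapseEntry.2.1) ∧
    ∀ σ : Triple 6, σ ≠ τ → initialMask.testBit σ.code = initialMask.testBit τ.code →
      σ.boundaryCoeff τ.collapseEntry.1 τ.collapseEntry.2.1 ≠ 0 →
      σ.collapseEntry.2.2 < τ.collapseEntry.2.2 := by
  -- Being a unit is replaced by `±1` to make the statement decidable.
  have h : ∀ τ : Triple 6, (0 < τ.collapseEntry.1 ∧ τ.collapseEntry.1 < τ.collapseEntry.2.1) ∧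
      (τ.boundaryCoeff τ.collapseEntry.1 τ.collapseEntry.2.1 = 1 ∨
        τ.boundaryCoeff τ.collapseEntry.1 τ.collapseEntry.2.1 = -1) ∧
      ∀ σ : Triple 6, σ ≠ τ → initialMask.testBit σ.code = initialMask.testBit τ.code →
        σ.boundaryCoeff τ.collapseEntry.1 τ.collapseEntry.2.1 ≠ 0 →
        σ.collapseEntry.2.2 < τ.collapseEntry.2.2 := by
    decide +kernel
  exact ⟨(h τ).1, Int.isUnit_iff.2 (h τ).2.1, (h τ).2.2⟩

section Existence

variable {k : Type*} [Field k] {V : Type*} [AddCommGroup V] [Module k V]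

/-- The vector `v` placed on a triple, sent to its boundary. -/
def boundaryMap (k : Type*) [Field k] {V : Type*} [AddCommGroup V] [Module k V] (τ : Triple 6) :
    V →ₗ[k] ReducedEdge 6 → V :=
  LinearMap.pi fun p => (τ.boundaryCoeff p.1.1 p.1.2 : k) • LinearMap.id

theorem boundaryMap_apply (τ : Triple 6) (v : V) (p : ReducedEdge 6) :
    boundaryMap k τ v p = (τ.boundaryCoeff p.1.1 p.1.2 : k) • v := rfl

/-- The basis of the target of the boundary map induced by a basis of `V`. -/
noncomputable def boundaryBasis (e : Module.Basis (Fin 2) k V) :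
    Module.Basis (Triple 6) k (ReducedEdge 6 → V) :=
  (Pi.basis fun _ : ReducedEdge 6 => e).reindex (Fintype.equivOfCardEq card_triple_six)

/-- The determinant of the boundary map of the complete complex on six vertices, with the
coefficients of the triples taken along given vectors of `V`. -/
noncomputable def boundaryDet (e : Module.Basis (Fin 2) k V) :
    MultilinearMap k (fun _ : Triple 6 => V) k :=
  (boundaryBasis e).det.toMultilinearMap.compLinearMap (boundaryMap k)

theorem boundaryDet_apply (e : Module.Basis (Fin 2) k V) (v : Triple 6 → V) :
    boundaryDet e v = (boundaryBasis e).det fun τ => boundaryMap k τ (v τ) := by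
  rw [boundaryDet, MultilinearMap.compLinearMap_apply, AlternatingMap.coe_multilinearMap]

theorem boundaryDet_eq_zero (e : Module.Basis (Fin 2) k V) {v : Triple 6 → V}
    (hv : HasEqualFaces v) : boundaryDet e v = 0 := by
  obtain ⟨x, y, z, t, hxy, hyz, hzt, h₁, h₂, h₃⟩ := hv
  rw [boundaryDet_apply]
  refine AlternatingMap.map_linearDependent (boundaryBasis e).det _ fun hli => ?_
  rw [Fintype.linearIndependent_iff] at hli
  set a : Triple 6 := ⟨x, y, z, hxy, hyz⟩ with ha
  set b : Triple 6 := ⟨x, y, t, hxy, hyz.trans hzt⟩ with hb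
  set c : Triple 6 := ⟨x, z, t, hxy.trans hyz, hzt⟩ with hc
  set d : Triple 6 := ⟨y, z, t, hyz, hzt⟩ with hd
  have hab : a ≠ b := by simp [ha, hb, hzt.ne]
  have hac : a ≠ c := by simp [ha, hc, hyz.ne]
  have had : a ≠ d := by simp [ha, hd, hxy.ne]
  -- The signs are those of the tetrahedron's boundary, up to a global sign; since the four vectors
  -- agree, the boundary of this combination is zero, although its coefficient at `a` is `1`.
  have := hli (Pi.single a 1 - Pi.single b 1 + Pi.single c 1 - Pi.single d 1) (by
    simp only [Pi.sub_apply, Pi.add_apply, sub_smul, add_smul, Finset.sum_sub_distrib,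
      Finset.sum_add_distrib, Pi.single_apply, ite_smul, one_smul, zero_smul, Finset.sum_ite_eq',
      Finset.mem_univ, if_true]
    funext p
    simp only [Pi.sub_apply, Pi.add_apply, Pi.zero_apply, boundaryMap_apply]
    rw [← h₃, ← h₂, ← h₁, ← sub_smul, ← add_smul, ← sub_smul]
    convert zero_smul k (v a)
    simp only [Triple.boundaryCoeff, ha, hb, hc, hd]
    push_cast
    ring) a
  simp [hab, hac, had] at this

/-- The two coordinates of `e` separate the triples inside the mask from those outside. On either
side, induction on the rank works: at the collapse edge of `τ` only lower-ranked triples compete,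
and their coefficients are already zero. -/
theorem linearIndependent_boundaryMap (e : Module.Basis (Fin 2) k V) :
    LinearIndependent k fun τ =>
      boundaryMap k τ (maskFamily (e 0) (e 1) initialMask τ) := by
  rw [Fintype.linearIndependent_iff]
  intro g hg τ
  induction hr : τ.collapseEntry.2.2 using Nat.strong_induction_on generalizing τ with
  | _ r ih =>
    subst hr
    obtain ⟨hedge, hunit, hlt⟩ := τ.collapseEntry_spec
    have hsum := congrArg (e.coord (if initialMask.testBit τ.code then 1 else 0))
      (congrFun hg ⟨(τ.collapseEntry.1, τ.collapseEntry.2.1), hedge⟩)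
    rw [Finset.sum_apply, map_sum, Finset.sum_eq_single τ] at hsum
    · have hk : ((τ.boundaryCoeff τ.collapseEntry.1 τ.collapseEntry.2.1 : ℤ) : k) ≠ 0 :=
        (hunit.map (Int.castRingHom k)).ne_zero
      have hcoord : e.coord (if initialMask.testBit τ.code then 1 else 0)
          (maskFamily (e 0) (e 1) initialMask τ) = 1 := by
        cases h : initialMask.testBit τ.code <;> simp [maskFamily, h]
      rw [Pi.smul_apply, boundaryMap_apply, map_smul, map_smul, hcoord] at hsum
      simpa [hk] using hsum
    · intro σ _ hσ
      rw [Pi.smul_apply, boundaryMap_apply, map_smul, map_smul]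
      by_cases hside : initialMask.testBit σ.code = initialMask.testBit τ.code
      · by_cases hc : σ.boundaryCoeff τ.collapseEntry.1 τ.collapseEntry.2.1 = 0
        · simp [hc]
        · rw [ih _ (hlt σ hσ hside hc) σ rfl, zero_smul]
      · have : e.coord (if initialMask.testBit τ.code then 1 else 0)
            (maskFamily (e 0) (e 1) initialMask σ) = 0 := by
          revert hside
          cases h : initialMask.testBit τ.code <;> cases h' : initialMask.testBit σ.code <;>
            simp [maskFamily, h']
        rw [this, smul_zero, smul_zero]
    · exact fun h => (h (Finset.mem_univ τ)).elim

theorem boundaryDet_initialMask_ne_zero (e : Module.Basis (Fin 2) k V) :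
    boundaryDet e (maskFamily (e 0) (e 1) initialMask) ≠ 0 := by
  rw [boundaryDet_apply]
  have hli := linearIndependent_boundaryMap e
  have : Module.Finite k (ReducedEdge 6 → V) := Module.Finite.of_basis (boundaryBasis e)
  have hspan := hli.span_eq_top_of_card_eq_finrank' (Module.finrank_eq_card_basis (boundaryBasis e)).symm
  exact ((Module.Basis.is_basis_iff_det (boundaryBasis e)).1 ⟨hli, hspan⟩).ne_zero

end Existence

theorem corollary4p10 {k : Type*} [Field k] [Infinite k]
    (hchar2 : ringChar k ≠ 2) (hchar3 : ringChar k ≠ 3)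
    {V : Type*} [AddCommGroup V] [Module k V] (hV : Module.finrank k V = 2) :
    Module.finrank k (LambdaS3 k V 6) = 1 ∧
    ∃ D : TS3 k V 6 →ₗ[k] k,
      D ≠ 0 ∧
      (∀ v : Triple 6 → V, HasEqualFaces v → D (PiTensorProduct.tprod k v) = 0) ∧
      ∀ D' : TS3 k V 6 →ₗ[k] k,
        (∀ v : Triple 6 → V, HasEqualFaces v → D' (PiTensorProduct.tprod k v) = 0) →
        ∃ c : k, D' = c • D := by
  have : Module.Finite k V := Module.finite_of_finrank_eq_succ hV
  let e : Module.Basis (Fin 2) k V := Module.finBasisOfFinrankEq k V hV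
  let w := maskFamily (e 0) (e 1) initialMask
  let D : TS3 k V 6 →ₗ[k] k := PiTensorProduct.lift (boundaryDet e)
  have hDw : D (PiTensorProduct.tprod k w) ≠ 0 := by
    rw [PiTensorProduct.lift.tprod]
    exact boundaryDet_initialMask_ne_zero e
  have hD0 : D ≠ 0 := fun h => hDw (by rw [h, LinearMap.zero_apply])
  have hD (v : Triple 6 → V) (hv : HasEqualFaces v) : D (PiTensorProduct.tprod k v) = 0 := by
    rw [PiTensorProduct.lift.tprod]
    exact boundaryDet_eq_zero e hv
  have huniq (D' : TS3 k V 6 →ₗ[k] k)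
      (hD' : ∀ v : Triple 6 → V, HasEqualFaces v → D' (PiTensorProduct.tprod k v) = 0) :
      ∃ c : k, D' = c • D := by
    -- This ratio makes `D' - c • D` vanish at the initial mask, hence everywhere.
    let c := D' (PiTensorProduct.tprod k w) / D (PiTensorProduct.tprod k w)
    refine ⟨c, sub_eq_zero.1 (PiTensorProduct.ext ?_)⟩
    refine eq_zero_of_initialMask _ (fun v hv => ?_) e ?_
    · simp [hD v hv, hD' v hv]
    · change D' (PiTensorProduct.tprod k w) - c * D (PiTensorProduct.tprod k w) = 0
      rw [div_mul_cancel₀ _ hDw, sub_self]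
  refine ⟨?_, D, hD0, hD, huniq⟩
  have hle : ES3 k V 6 ≤ LinearMap.ker D :=
    Submodule.span_le.2 fun ω ⟨v, hv, hω⟩ => by rw [hω]; exact hD v hv
  let φ : LambdaS3 k V 6 →ₗ[k] k := (ES3 k V 6).liftQ D hle
  have hinj : Function.Injective φ := by
    -- Functionals separate points of the quotient, and each pulls back to a multiple of `D`; so the
    -- kernel of `φ` is zero.
    refine (injective_iff_map_eq_zero φ).2 fun q hq => ?_
    obtain ⟨ω, rfl⟩ := Submodule.mkQ_surjective _ q
    refine (Module.forall_dual_apply_eq_zero_iff k _).1 fun ψ => ?_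
    obtain ⟨c, hc⟩ := huniq (ψ ∘ₗ (ES3 k V 6).mkQ) fun v hv => by
      have : (ES3 k V 6).mkQ (PiTensorProduct.tprod k v) = 0 :=
        (Submodule.Quotient.mk_eq_zero _).2 (Submodule.subset_span ⟨v, hv, rfl⟩)
      rw [LinearMap.comp_apply, this, map_zero]
    have hω : D ω = 0 := hq
    change (ψ ∘ₗ (ES3 k V 6).mkQ) ω = 0
    rw [hc, LinearMap.smul_apply, hω, smul_zero]
  have hsurj : Function.Surjective φ := LinearMap.surjective fun h => hDw (by
    change φ ((ES3 k V 6).mkQ (PiTensorProduct.tprod k w)) = 0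
    rw [h, LinearMap.zero_apply])
  rw [(LinearEquiv.ofBijective φ ⟨hinj, hsurj⟩).finrank_eq, Module.finrank_self]
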